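/- Let $M\in\mathbb R^{n\times n}$, $q\in\mathbb R^n$ and $Q\in\mathbb R^{n\times d}$ with $\operatorname{rank}Q=d$. Assume that $M$ is sufficient, i.e. both $N=M$ and $N=M^T$ satisfy: for all $z\in\mathbb R^n$, if $z_i(Nz)_i\le 0$ for all $i$, then $z_i(Nz)_i=0$ for all $i$. Notation. Put $A=[\,I\;\;{-M}\,]\in\mathbb R^{n\times 2n}$. A complementary basis is a set $B\subset\{1,\dots,2n\}$ with $|B|=n$, $\operatorname{rank}A_B=n$ (where $A_B$ consists of the columns of $A$ indexed by $B$) and $|B\cap\{i,i+n\}|=1$ for $i=1,\dots,n$; $\mathcal C(B)$ is the cone of all nonnegative combinations of the columns of $A_B$. Let $K(M)$ be the set of all $y\in\mathbb R^n$ for which there are $w,z\ge 0$ with $w-Mz=y$ and $w^Tz=0$. Let $S=\{q+Q\theta:\theta\in\mathbb R^d\}$, $S_B=\mathcal C(B)\cap S$ (the critical domain of $B$), $S_f=K(M)\cap S$, and for $\epsilon>0$ let $S^\epsilon=S+(\epsilon,\epsilon^2,\dots,\epsilon^n)^T$ and $S^\epsilon_B=\mathcal C(B)\cap S^\epsilon$.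 The dimension of a nonempty set is that of its affine hull; the empty set has dimension $-\infty$. The critical domain graph $G^\epsilon=(V^\epsilon,E^\epsilon)$ relative to $S^\epsilon$ has as nodes the complementary bases $B$ with $\dim S^\epsilon_B=d$ and as edges the pairs of distinct nodes $B,B'$ with $\dim(S^\epsilon_B\cap S^\epsilon_{B'})=d-1$. Let $V=\{B\in V^\epsilon:\dim S_B=d\}$. Then there is $\delta>0$ such that for every $\epsilon\in(0,\delta)$ the following hold. 1. $S_B\neq\emptyset$ for each $B\in V^\epsilon$. 2. For any two distinct $B_1,B_2\in V$, the relative interiors of $S_{B_1}$ and $S_{B_2}$ are disjoint. 3. If $S_f$ is empty or has dimension $d$, then $\bigcup_{B\in V}S_B=S_f$, and $\{S_B:B\in V\}$ is a polyhedral decomposition of $S_f$: each member is a convex polyhedron of dimension $d$, the union of the members is $S_f$, and $\dim(P\cap P')\le d-1$ for any two distinct members $P,P'$. -/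

import Mathlib

namespace ParamLCP

open scoped Matrix

/-- Column sufficiency: `z_i (M z)_i ≤ 0` for all `i` forces `z_i (M z)_i = 0` for all `i`. -/
def IsColumnSufficient {n : ℕ} (M : Matrix (Fin n) (Fin n) ℝ) : Prop :=
  ∀ z : Fin n → ℝ, (∀ i, z i * (M *ᵥ z) i ≤ 0) → ∀ i, z i * (M *ᵥ z) i = 0

/-- A sufficient matrix is column sufficient together with its transpose. -/
def IsSufficient {n : ℕ} (M : Matrix (Fin n) (Fin n) ℝ) : Prop :=
  IsColumnSufficient M ∧ IsColumnSufficient Mᵀ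

/-- The matrix `A = [I  -M]`. Its `2n` columns are indexed by `Fin n ⊕ Fin n`; the complementary
indices `i` and `i + n` are `Sum.inl i` and `Sum.inr i`. -/
def augMatrix {n : ℕ} (M : Matrix (Fin n) (Fin n) ℝ) : Matrix (Fin n) (Fin n ⊕ Fin n) ℝ :=
  Matrix.fromCols 1 (-M)

/-- The submatrix `A_J` formed by the columns of `A = [I  -M]` indexed by `J`. -/
def colSubmatrix {n : ℕ} (M : Matrix (Fin n) (Fin n) ℝ) (J : Finset (Fin n ⊕ Fin n)) :
    Matrix (Fin n) J ℝ :=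
  (augMatrix M).submatrix id Subtype.val

/-- `B` is a complementary basis: `|B| = n`, `rank A_B = n`, and `B` contains exactly one of the
indices `i`, `i + n` for every `i`. -/
def IsComplementaryBasis {n : ℕ} (M : Matrix (Fin n) (Fin n) ℝ)
    (B : Finset (Fin n ⊕ Fin n)) : Prop :=
  B.card = n ∧ (colSubmatrix M B).rank = n ∧ ∀ i : Fin n, Xor (Sum.inl i ∈ B) (Sum.inr i ∈ B)

/-- `cone T`: all nonnegative combinations of the columns of `T`. -/
def cone {n : ℕ} {κ : Type*} [Fintype κ] (T : Matrix (Fin n) κ ℝ) : Set (Fin n → ℝ) :=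
  {y | ∃ x : κ → ℝ, (∀ k, 0 ≤ x k) ∧ T *ᵥ x = y}

/-- The cone `C(J) = cone A_J`. -/
def complementaryCone {n : ℕ} (M : Matrix (Fin n) (Fin n) ℝ) (J : Finset (Fin n ⊕ Fin n)) :
    Set (Fin n → ℝ) :=
  cone (colSubmatrix M J)

/-- The complementary range `K(M)`: the right-hand sides `y` for which the linear complementarity
problem `w - M z = y`, `w ≥ 0`, `z ≥ 0`, `wᵀ z = 0` has a solution. -/
def complementaryRange {n : ℕ} (M : Matrix (Fin n) (Fin n) ℝ) : Set (Fin n → ℝ) :=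
  {y | ∃ w z : Fin n → ℝ, w - M *ᵥ z = y ∧ (∀ i, 0 ≤ w i) ∧ (∀ i, 0 ≤ z i) ∧ w ⬝ᵥ z = 0}

/-- The affine subspace `S = {q + Q θ | θ ∈ ℝ^d}`. -/
def affineSpace {n d : ℕ} (q : Fin n → ℝ) (Q : Matrix (Fin n) (Fin d) ℝ) : Set (Fin n → ℝ) :=
  {y | ∃ θ : Fin d → ℝ, y = q + Q *ᵥ θ}

/-- The lexicographic perturbation vector `(ε, ε², …, εⁿ)`. -/
def lexVector (n : ℕ) (ε : ℝ) : Fin n → ℝ :=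
  fun i => ε ^ ((i : ℕ) + 1)

/-- The critical domain `S_B = C(B) ∩ S`. -/
def criticalDomain {n d : ℕ} (M : Matrix (Fin n) (Fin n) ℝ) (q : Fin n → ℝ)
    (Q : Matrix (Fin n) (Fin d) ℝ) (B : Finset (Fin n ⊕ Fin n)) : Set (Fin n → ℝ) :=
  complementaryCone M B ∩ affineSpace q Q

/-- The feasible points `S_f = K(M) ∩ S` of `S`. -/
def feasibleSet {n d : ℕ} (M : Matrix (Fin n) (Fin n) ℝ) (q : Fin n → ℝ)
    (Q : Matrix (Fin n) (Fin d) ℝ) : Set (Fin n → ℝ) :=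
  complementaryRange M ∩ affineSpace q Q

open Classical in
/-- The dimension of (the affine hull of) a set, with the empty set of dimension `⊥`. -/
noncomputable def affDim {n : ℕ} (P : Set (Fin n → ℝ)) : WithBot ℕ :=
  if P.Nonempty then ((Module.finrank ℝ (vectorSpan ℝ P) : ℕ) : WithBot ℕ) else ⊥

/-- The critical domain graph `(V, E)` for the space `q + Q ℝ^d`: the vertices are the
complementary bases `B` with `dim S_B = d`, and two distinct vertices are joined when
`dim (S_B ∩ S_{B'}) = d - 1`. -/
def criticalDomainGraph {n d : ℕ} (M : Matrix (Fin n) (Fin n) ℝ) (q : Fin n → ℝ)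
    (Q : Matrix (Fin n) (Fin d) ℝ) : (⊤ : SimpleGraph (Finset (Fin n ⊕ Fin n))).Subgraph where
  verts := {B | IsComplementaryBasis M B ∧ affDim (criticalDomain M q Q B) = (d : WithBot ℕ)}
  Adj B B' :=
    (IsComplementaryBasis M B ∧ affDim (criticalDomain M q Q B) = (d : WithBot ℕ)) ∧
    (IsComplementaryBasis M B' ∧ affDim (criticalDomain M q Q B') = (d : WithBot ℕ)) ∧
    B ≠ B' ∧ affDim (criticalDomain M q Q B ∩ criticalDomain M q Q B') + 1 = (d : WithBot ℕ)
  adj_sub h := h.2.2.1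
  edge_vert h := h.1
  symm := ⟨fun _ _ h => ⟨h.2.1, h.1, h.2.2.1.symm, by rw [Set.inter_comm]; exact h.2.2.2⟩⟩

/-- A convex polyhedron: the solution set of finitely many weak linear inequalities. -/
def IsPolyhedron {n : ℕ} (P : Set (Fin n → ℝ)) : Prop :=
  ∃ (m : ℕ) (H : Matrix (Fin m) (Fin n) ℝ) (b : Fin m → ℝ), P = {y | ∀ k, (H *ᵥ y) k ≤ b k}

/-- `𝒦` is a polyhedral decomposition of `X` into `d`-dimensional pieces. -/
structure IsPolyhedralDecomposition {n : ℕ} (d : ℕ) (𝒦 : Set (Set (Fin n → ℝ)))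
    (X : Set (Fin n → ℝ)) : Prop where
  polyhedron : ∀ P ∈ 𝒦, IsPolyhedron P
  cover : (⋃ P ∈ 𝒦, P) = X
  dim_eq : ∀ P ∈ 𝒦, affDim P = (d : WithBot ℕ)
  dim_inter : ∀ P ∈ 𝒦, ∀ P' ∈ 𝒦, P ≠ P' → affDim (P ∩ P') < (d : WithBot ℕ)

end ParamLCP

/-! Each half of sufficiency has its own task. Sufficiency of `Mᵀ` makes `K(M)` the convex cone
generated by all columns of `[I -M]`: on the feasible polyhedron of `y`, `zᵀ(y + Mz)` attains its
minimum by Frank–Wolfe, and the KKT conditions force that minimum to be complementary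
(`complementaryRange_eq_cone`). Sufficiency of `M` forbids one right-hand side from having
nondegenerate complementary solutions on two different index sets (`eq_of_pos_of_mulVec_eq`).

For small `ε` the vector `q + (ε, …, εⁿ)` avoids every proper subspace spanned by columns. Hence
interior points of the perturbed full-dimensional domains are nondegenerate. Adding a small multiple
of such a point to a common interior point of two unperturbed domains yields a common right-hand
side with nondegenerate solutions for both bases, so the bases agree
(`eq_of_mem_interior_of_mem_interior`). Since `Q` is injective, dimension `d` just means nonempty
interior in parameter space.

For the cover, `V^ε` has finitely many possible values, so for small `ε` its value recurs at
arbitrarily small `ε'`. Each feasible `y`, shifted by the vector of such an `ε'`, lies in a cone of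
`V^ε'`, which equals `V^ε`; the union of these cones is closed, so `y` lies in it. If the feasible
set is full-dimensional, domains of lower dimension can be dropped from this finite closed cover.
Nonemptiness of `S_B` is a closed condition on `q`, which gives the first claim. -/

namespace ParamLCP

open scoped Matrix
open Filter Topology

/-! ### Existence of minimizers in quadratic programming -/

section QuadraticProgramming

variable {ι κ : Type*} [Fintype ι]

/-- The quadratic function `x ↦ xᵀ C x + cᵀ x`. -/
def quadFun (C : Matrix ι ι ℝ) (c x : ι → ℝ) : ℝ := x ⬝ᵥ (C *ᵥ x) + c ⬝ᵥ x

/-- The polyhedron `{x | b ≤ H x}`. -/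
def lowerPolyhedron (H : Matrix κ ι ℝ) (b : κ → ℝ) : Set (ι → ℝ) := {x | ∀ k, b k ≤ (H *ᵥ x) k}

lemma continuous_quadFun (C : Matrix ι ι ℝ) (c : ι → ℝ) : Continuous (quadFun C c) := by
  unfold quadFun; fun_prop

lemma isClosed_lowerPolyhedron (H : Matrix κ ι ℝ) (b : κ → ℝ) :
    IsClosed (lowerPolyhedron H b) := by
  simp only [lowerPolyhedron, Set.ofPred_forall]
  exact isClosed_iInter fun k => isClosed_le (by fun_prop) (by fun_prop)

lemma quadFun_add_smul (C : Matrix ι ι ℝ) (c x h : ι → ℝ) (t : ℝ) :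
    quadFun C c (x + t • h) =
      quadFun C c x + t * ((C *ᵥ x + Cᵀ *ᵥ x + c) ⬝ᵥ h) + t ^ 2 * (h ⬝ᵥ (C *ᵥ h)) := by
  have e : (Cᵀ *ᵥ x) ⬝ᵥ h = x ⬝ᵥ (C *ᵥ h) := by
    rw [Matrix.dotProduct_mulVec, Matrix.mulVec_transpose]
  have e2 : (C *ᵥ x) ⬝ᵥ h = h ⬝ᵥ (C *ᵥ x) := dotProduct_comm _ _
  simp only [quadFun, Matrix.mulVec_add, Matrix.mulVec_smul, add_dotProduct, dotProduct_add,
    smul_dotProduct, dotProduct_smul, smul_eq_mul, e, e2]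
  ring

lemma norm_sq_le_dotProduct_self (x : ι → ℝ) : ‖x‖ ^ 2 ≤ x ⬝ᵥ x := by
  have h0 : 0 ≤ x ⬝ᵥ x := Finset.sum_nonneg fun i _ => mul_self_nonneg _
  have h : ‖x‖ ≤ √(x ⬝ᵥ x) := by
    refine (pi_norm_le_iff_of_nonneg (Real.sqrt_nonneg _)).2 fun i => Real.abs_le_sqrt ?_
    rw [sq]
    exact Finset.single_le_sum (f := fun i => x i * x i) (fun i _ => mul_self_nonneg _)
      (Finset.mem_univ i)
  calc ‖x‖ ^ 2 ≤ √(x ⬝ᵥ x) ^ 2 := by gcongr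
    _ = _ := Real.sq_sqrt h0

/-- The term `η (x ⬝ᵥ x)` makes the objective coercive; Frank–Wolfe follows by letting `η → 0`. -/
lemma exists_quadFun_add_le (C : Matrix ι ι ℝ) (c : ι → ℝ) (H : Matrix κ ι ℝ) (b : κ → ℝ)
    (hne : (lowerPolyhedron H b).Nonempty) (m : ℝ)
    (hm : ∀ x ∈ lowerPolyhedron H b, m ≤ quadFun C c x) {η : ℝ} (hη : 0 < η) :
    ∃ x ∈ lowerPolyhedron H b, ∀ y ∈ lowerPolyhedron H b,
      quadFun C c x + η * (x ⬝ᵥ x) ≤ quadFun C c y + η * (y ⬝ᵥ y) := by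
  obtain ⟨z, hz⟩ := hne
  have hc : Continuous fun x : ι → ℝ => quadFun C c x + η * (x ⬝ᵥ x) :=
    (continuous_quadFun C c).add (by fun_prop)
  refine (hc.continuousOn).exists_isMinOn' (isClosed_lowerPolyhedron H b) hz ?_
  have ht : Tendsto (fun x : ι → ℝ => m + η * ‖x‖ ^ 2) (cocompact _) atTop :=
    tendsto_atTop_add_const_left _ _ <|
      (((tendsto_pow_atTop two_ne_zero).comp (tendsto_norm_cocompact_atTop))).const_mul_atTop hη
  filter_upwards [(ht.mono_left inf_le_left).eventually_ge_atTop (quadFun C c z + η * (z ⬝ᵥ z)),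
    mem_inf_of_right (mem_principal_self _)] with x hx hxP
  have := mul_le_mul_of_nonneg_left (norm_sq_le_dotProduct_self x) hη.le
  linarith [hm x hxP]

variable [Fintype κ]

/-- An unbounded sequence in a polyhedron has a limit direction `v`, a recession direction of the
polyhedron; moving a far-out member of the sequence slightly along `-v` keeps it in the polyhedron
and decreases its Euclidean norm. -/
lemma exists_recession_direction (H : Matrix κ ι ℝ) (b : κ → ℝ) {x : ℕ → ι → ℝ}
    (hx : ∀ k, x k ∈ lowerPolyhedron H b) (hinf : Tendsto (fun k => ‖x k‖) atTop atTop) :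
    ∃ (v : ι → ℝ) (φ : ℕ → ℕ), StrictMono φ ∧
      Tendsto (fun k => ‖x (φ k)‖⁻¹ • x (φ k)) atTop (𝓝 v) ∧ (∀ j, 0 ≤ (H *ᵥ v) j) ∧
      ∀ᶠ k in atTop, ∀ᶠ t : ℝ in 𝓝[>] 0, x (φ k) + (-t) • v ∈ lowerPolyhedron H b ∧
        (x (φ k) + (-t) • v) ⬝ᵥ (x (φ k) + (-t) • v) < x (φ k) ⬝ᵥ x (φ k) := by
  have hball : ∀ k, ‖x k‖⁻¹ • x k ∈ Metric.closedBall (0 : ι → ℝ) 1 := fun k => by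
    rw [mem_closedBall_zero_iff, norm_smul, norm_inv, norm_norm]
    exact inv_mul_le_one
  obtain ⟨v, -, φ, hφ, hv⟩ := (isCompact_closedBall (0 : ι → ℝ) 1).tendsto_subseq hball
  have hinf' : Tendsto (fun k => ‖x (φ k)‖) atTop atTop := hinf.comp hφ.tendsto_atTop
  have hpos : ∀ᶠ k in atTop, 0 < ‖x (φ k)‖ := hinf'.eventually_gt_atTop 0
  have hnorm : ‖v‖ = 1 := by
    refine tendsto_nhds_unique hv.norm (tendsto_const_nhds.congr' ?_)
    filter_upwards [hpos] with k hk
    simp [norm_smul, hk.ne']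
  have hv0 : 0 < v ⬝ᵥ v :=
    lt_of_lt_of_le (by rw [hnorm]; norm_num) (norm_sq_le_dotProduct_self v)
  have hH : ∀ j, Tendsto (fun k => ‖x (φ k)‖⁻¹ * (H *ᵥ x (φ k)) j) atTop (𝓝 ((H *ᵥ v) j)) := by
    intro j
    have hc : Continuous fun y : ι → ℝ => (H *ᵥ y) j := by fun_prop
    refine ((hc.tendsto v).comp hv).congr fun k => ?_
    simp [Matrix.mulVec_smul]
  have hb : ∀ a : ℝ, Tendsto (fun k => ‖x (φ k)‖⁻¹ * a) atTop (𝓝 0) := fun a => by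
    simpa using hinf'.inv_tendsto_atTop.mul_const a
  have hHv : ∀ j, 0 ≤ (H *ᵥ v) j := fun j =>
    le_of_tendsto_of_tendsto' (hb (b j)) (hH j) fun k =>
      mul_le_mul_of_nonneg_left (hx _ j) (by positivity)
  refine ⟨v, φ, hφ, hv, hHv, ?_⟩
  -- Each constraint is either constant along `v` or eventually slack, so neither kind blocks a
  -- short step along `-v`.
  have hactive : ∀ j, ∀ᶠ k in atTop, (H *ᵥ v) j = 0 ∨ b j < (H *ᵥ x (φ k)) j := by
    intro j
    rcases (hHv j).eq_or_lt with h | h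
    · exact Eventually.of_forall fun k => Or.inl h.symm
    · filter_upwards [(hb (b j)).eventually_lt (hH j) h, hpos] with k hk hk0
      exact Or.inr (lt_of_mul_lt_mul_left hk (by positivity))
  have hdot : Tendsto (fun k => ‖x (φ k)‖⁻¹ * (x (φ k) ⬝ᵥ v)) atTop (𝓝 (v ⬝ᵥ v)) := by
    have hc : Continuous fun y : ι → ℝ => y ⬝ᵥ v := by fun_prop
    refine ((hc.tendsto v).comp hv).congr fun k => ?_
    simp
  filter_upwards [eventually_all.2 hactive, hdot.eventually_const_lt hv0, hpos] with k hk hkv hk0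
  have hxv : 0 < x (φ k) ⬝ᵥ v := pos_of_mul_pos_right hkv (by positivity)
  refine Eventually.and ?_ ?_
  · refine eventually_all.2 fun j => ?_
    rcases hk j with h | h
    · exact Eventually.of_forall fun t => by
        simpa [Matrix.mulVec_add, Matrix.mulVec_smul, Matrix.mulVec_neg, h] using hx (φ k) j
    · have hc : Continuous fun t : ℝ => (H *ᵥ (x (φ k) + (-t) • v)) j := by fun_prop
      have := (hc.tendsto 0).mono_left (nhdsWithin_le_nhds (s := Set.Ioi 0))
      simp only [neg_zero, zero_smul, add_zero] at this
      exact (this.eventually_const_lt h).mono fun _ => le_of_lt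
  · have h2 : 0 < 2 * (x (φ k) ⬝ᵥ v) / (v ⬝ᵥ v) := by positivity
    filter_upwards [Ioo_mem_nhdsGT h2] with t ht
    have h3 : t * (v ⬝ᵥ v) < 2 * (x (φ k) ⬝ᵥ v) := (lt_div_iff₀ hv0).1 ht.2
    have := mul_lt_mul_of_pos_left h3 ht.1
    simp only [add_dotProduct, dotProduct_add, smul_dotProduct, dotProduct_smul, smul_eq_mul,
      dotProduct_comm v (x (φ k))]
    linarith

/-- The **Frank–Wolfe theorem**: a quadratic function that is bounded below on a nonempty
polyhedron attains its minimum there. -/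
theorem exists_forall_quadFun_le (C : Matrix ι ι ℝ) (c : ι → ℝ) (H : Matrix κ ι ℝ) (b : κ → ℝ)
    (hne : (lowerPolyhedron H b).Nonempty) (m : ℝ)
    (hm : ∀ x ∈ lowerPolyhedron H b, m ≤ quadFun C c x) :
    ∃ x ∈ lowerPolyhedron H b, ∀ y ∈ lowerPolyhedron H b, quadFun C c x ≤ quadFun C c y := by
  have hη : ∀ k : ℕ, (0 : ℝ) < 1 / ((k : ℝ) + 1) := fun k => by positivity
  have hη0 : Tendsto (fun k : ℕ => 1 / ((k : ℝ) + 1)) atTop (𝓝 0) :=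
    tendsto_one_div_add_atTop_nhds_zero_nat
  choose x hxP hx using fun k => exists_quadFun_add_le C c H b hne m hm (hη k)
  have hself : ∀ y : ι → ℝ, 0 ≤ y ⬝ᵥ y := fun y => Finset.sum_nonneg fun i _ => mul_self_nonneg _
  by_cases hbdd : ∃ R, ∃ᶠ k in atTop, ‖x k‖ ≤ R
  · obtain ⟨R, hR⟩ := hbdd
    obtain ⟨a, -, φ, hφ, ha⟩ := (isCompact_closedBall (0 : ι → ℝ) R).tendsto_subseq'
      (hR.mono fun k hk => by simpa using hk)
    refine ⟨a, (isClosed_lowerPolyhedron H b).mem_of_tendsto ha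
      (Eventually.of_forall fun k => hxP _), fun y hy => ?_⟩
    have h1 := ((continuous_quadFun C c).tendsto a).comp ha
    have h2 := ((hη0.comp hφ.tendsto_atTop).mul_const (y ⬝ᵥ y)).const_add (quadFun C c y)
    rw [zero_mul, add_zero] at h2
    refine le_of_tendsto_of_tendsto' h1 h2 fun k => ?_
    have := mul_nonneg (hη (φ k)).le (hself (x (φ k)))
    have := hx (φ k) y hy
    simp only [Function.comp]
    linarith
  -- If the regularized minimizers escape to infinity along `v`, then `v` has nonpositive curvature
  -- and nonnegative slope. A short step along `-v` therefore does not raise the quadratic but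
  -- shrinks the norm, against regularized minimality.
  · exfalso
    push Not at hbdd
    have hinf : Tendsto (fun k => ‖x k‖) atTop atTop :=
      tendsto_atTop.2 fun R => (hbdd R).mono fun k => le_of_lt
    obtain ⟨v, φ, hφ, hv, hHv, hdesc⟩ := exists_recession_direction H b hxP hinf
    have hinf' : Tendsto (fun k => ‖x (φ k)‖) atTop atTop := hinf.comp hφ.tendsto_atTop
    have hcurv : v ⬝ᵥ (C *ᵥ v) ≤ 0 := by
      obtain ⟨z, hz⟩ := hne
      set r : ℕ → ℝ := fun k => ‖x (φ k)‖⁻¹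
      have hr : Tendsto r atTop (𝓝 0) := hinf'.inv_tendsto_atTop
      have hc : Continuous fun y : ι → ℝ => y ⬝ᵥ (C *ᵥ y) := by fun_prop
      have hc' : Continuous fun y : ι → ℝ => c ⬝ᵥ y := by fun_prop
      have h1 := ((hc.tendsto v).comp hv).add (hr.mul ((hc'.tendsto v).comp hv))
      have h2 := (hr.mul hr).mul_const (quadFun C c z + z ⬝ᵥ z)
      simp only [zero_mul, add_zero] at h1 h2
      refine le_of_tendsto_of_tendsto' h1 h2 fun k => ?_
      have e : ((fun y : ι → ℝ => y ⬝ᵥ (C *ᵥ y)) ∘ fun k => ‖x (φ k)‖⁻¹ • x (φ k)) k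
          + r k * ((fun y : ι → ℝ => c ⬝ᵥ y) ∘ fun k => ‖x (φ k)‖⁻¹ • x (φ k)) k
          = r k * r k * quadFun C c (x (φ k)) := by
        simp only [Function.comp, quadFun, Matrix.mulVec_smul, smul_dotProduct, dotProduct_smul,
          smul_eq_mul, r]
        ring
      rw [e]
      refine mul_le_mul_of_nonneg_left ?_ (mul_self_nonneg _)
      have h3 := hx (φ k) z hz
      have h4 := mul_nonneg (hη (φ k)).le (hself (x (φ k)))
      have h5 : 1 / (((φ k : ℕ) : ℝ) + 1) * (z ⬝ᵥ z) ≤ 1 * (z ⬝ᵥ z) :=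
        mul_le_mul_of_nonneg_right (by
          rw [div_le_one (by positivity)]; linarith [Nat.cast_nonneg (α := ℝ) (φ k)]) (hself z)
      linarith
    obtain ⟨k, hk⟩ := hdesc.exists
    obtain ⟨t, ⟨hP, hlt⟩, ht⟩ := (hk.and self_mem_nhdsWithin).exists
    have ht : 0 < t := ht
    set y := x (φ k) with hy
    have hslope : 0 ≤ (C *ᵥ y + Cᵀ *ᵥ y + c) ⬝ᵥ v := by
      by_contra! hneg
      set a := (C *ᵥ y + Cᵀ *ᵥ y + c) ⬝ᵥ v
      -- This step length makes the linear term bring the value down to `m - 1`.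
      set s := (quadFun C c y - m + 1) / (-a)
      have hs : 0 ≤ s := div_nonneg (by linarith [hm y (hxP _)]) (by linarith)
      have hmem : y + s • v ∈ lowerPolyhedron H b := fun j => by
        have := mul_nonneg hs (hHv j)
        have := hxP (φ k) j
        simp only [Matrix.mulVec_add, Matrix.mulVec_smul, Pi.add_apply, Pi.smul_apply, smul_eq_mul]
        linarith
      have h1 := hm _ hmem
      rw [quadFun_add_smul] at h1
      have h2 : s * a = -(quadFun C c y - m + 1) := by
        rw [div_mul_eq_mul_div, div_neg, mul_div_cancel_right₀ _ hneg.ne]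
      have h3 := mul_nonpos_of_nonneg_of_nonpos (sq_nonneg s) hcurv
      linarith
    have h1 := hx (φ k) _ hP
    rw [quadFun_add_smul] at h1
    have h2 := mul_lt_mul_of_pos_left hlt (hη (φ k))
    have h3 := mul_nonpos_of_nonneg_of_nonpos (sq_nonneg (-t)) hcurv
    have h4 := mul_nonneg ht.le hslope
    linarith

end QuadraticProgramming

/-! ### Finitely generated cones, Farkas and KKT -/

section Cones

variable {n : ℕ} {κ : Type*} [Fintype κ]

lemma convex_cone (T : Matrix (Fin n) κ ℝ) : Convex ℝ (cone T) := by
  rintro _ ⟨x, hx, rfl⟩ _ ⟨y, hy, rfl⟩ a b ha hb -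
  refine ⟨a • x + b • y, fun k => ?_, by simp [Matrix.mulVec_add, Matrix.mulVec_smul]⟩
  have := mul_nonneg ha (hx k)
  have := mul_nonneg hb (hy k)
  simpa using by linarith

/-- A finitely generated cone is closed. -/
theorem isClosed_cone (T : Matrix (Fin n) κ ℝ) : IsClosed (cone T) := by
  classical
  refine isClosed_of_closure_subset fun y hy => ?_
  have hquad : ∀ x, quadFun (Tᵀ * T) (-2 • (Tᵀ *ᵥ y)) x =
      (T *ᵥ x - y) ⬝ᵥ (T *ᵥ x - y) - y ⬝ᵥ y := by
    intro x
    have e : x ⬝ᵥ ((Tᵀ * T) *ᵥ x) = (T *ᵥ x) ⬝ᵥ (T *ᵥ x) := by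
      rw [← Matrix.mulVec_mulVec, Matrix.dotProduct_mulVec, Matrix.vecMul_transpose]
    have e2 : (Tᵀ *ᵥ y) ⬝ᵥ x = y ⬝ᵥ (T *ᵥ x) := by
      rw [Matrix.dotProduct_mulVec, Matrix.mulVec_transpose]
    simp only [quadFun, e, smul_dotProduct, e2, sub_dotProduct, dotProduct_sub,
      dotProduct_comm (T *ᵥ x) y]
    simp only [zsmul_eq_mul]
    push_cast
    ring
  have hself : ∀ y : Fin n → ℝ, 0 ≤ y ⬝ᵥ y :=
    fun y => Finset.sum_nonneg fun i _ => mul_self_nonneg _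
  have hP : ∀ x : κ → ℝ, x ∈ lowerPolyhedron (1 : Matrix κ κ ℝ) 0 ↔ ∀ k, 0 ≤ x k := fun x => by
    simp [lowerPolyhedron]
  -- Frank–Wolfe gives a point of the cone nearest to `y`; as `y` is in the closure, the distance is
  -- zero.
  obtain ⟨x, hxP, hx⟩ := exists_forall_quadFun_le (Tᵀ * T) (-2 • (Tᵀ *ᵥ y)) (1 : Matrix κ κ ℝ) 0
    ⟨0, (hP 0).2 fun _ => le_rfl⟩ (-(y ⬝ᵥ y)) fun x _ => by
      rw [hquad]; linarith [hself (T *ᵥ x - y)]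
  refine ⟨x, (hP x).1 hxP, ?_⟩
  have hle : ∀ u ∈ closure (cone T), (T *ᵥ x - y) ⬝ᵥ (T *ᵥ x - y) ≤ (u - y) ⬝ᵥ (u - y) := by
    have hcl : IsClosed {u : Fin n → ℝ | (T *ᵥ x - y) ⬝ᵥ (T *ᵥ x - y) ≤ (u - y) ⬝ᵥ (u - y)} :=
      isClosed_le (by fun_prop) (by fun_prop)
    refine closure_minimal ?_ hcl
    rintro _ ⟨z, hz, rfl⟩
    have := hx z ((hP z).2 hz)
    rw [hquad, hquad] at this
    exact (sub_le_sub_iff_right _).1 this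
  have h0 := hle y hy
  rw [sub_self, zero_dotProduct] at h0
  exact sub_eq_zero.1 (dotProduct_self_eq_zero.1 (le_antisymm h0 (hself _)))

/-- **Farkas' lemma**. -/
theorem exists_nonneg_transpose_mulVec_eq (H : Matrix κ (Fin n) ℝ) (g : Fin n → ℝ)
    (hg : ∀ h : Fin n → ℝ, (∀ k, 0 ≤ (H *ᵥ h) k) → 0 ≤ g ⬝ᵥ h) :
    ∃ u : κ → ℝ, (∀ k, 0 ≤ u k) ∧ Hᵀ *ᵥ u = g := by
  classical
  by_contra hcon
  have hgc : g ∉ cone Hᵀ := hcon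
  obtain ⟨f, s, hfg, hf⟩ := geometric_hahn_banach_point_closed (convex_cone Hᵀ)
    (isClosed_cone Hᵀ) hgc
  set h : Fin n → ℝ := fun i => f (Pi.single i 1) with hh
  have hfh : ∀ y, f y = y ⬝ᵥ h := fun y => by
    conv_lhs => rw [← Finset.univ_sum_single y]
    rw [map_sum]
    refine Finset.sum_congr rfl fun i _ => ?_
    rw [hh, ← smul_eq_mul, ← map_smul, ← Pi.single_smul, smul_eq_mul, mul_one]
  have hs : s < 0 := by simpa using hf 0 ⟨0, fun _ => le_rfl, by simp⟩
  have hHh : ∀ k, 0 ≤ (H *ᵥ h) k := by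
    intro k
    by_contra! hk
    -- This multiple of the `k`-th generator has functional value exactly `s`, against strict
    -- separation.
    have := hf _ ⟨Pi.single k (s / (H *ᵥ h) k), fun j => by
      by_cases hj : j = k
      · subst hj; simpa using (div_pos_of_neg_of_neg hs hk).le
      · simp [hj], rfl⟩
    rw [hfh, Matrix.mulVec_transpose, ← Matrix.dotProduct_mulVec, single_dotProduct,
      div_mul_cancel₀ _ hk.ne] at this
    exact lt_irrefl _ this
  have := hg h hHh
  rw [← hfh] at this
  linarith

/-- The Karush–Kuhn–Tucker conditions for a quadratic program. -/
theorem exists_kkt_multiplier (C : Matrix (Fin n) (Fin n) ℝ) (c : Fin n → ℝ)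
    (H : Matrix κ (Fin n) ℝ) (b : κ → ℝ) {x : Fin n → ℝ} (hxP : x ∈ lowerPolyhedron H b)
    (hx : ∀ y ∈ lowerPolyhedron H b, quadFun C c x ≤ quadFun C c y) :
    ∃ u : κ → ℝ, (∀ k, 0 ≤ u k) ∧ (∀ k, u k * ((H *ᵥ x) k - b k) = 0) ∧
      Hᵀ *ᵥ u = C *ᵥ x + Cᵀ *ᵥ x + c := by
  classical
  -- `D` selects the active constraints, so `D * H *ᵥ h ≥ 0` makes `h` a feasible direction, and the
  -- multiplier `D *ᵥ u` satisfies slackness.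
  set D : Matrix κ κ ℝ := Matrix.diagonal fun k => if (H *ᵥ x) k = b k then 1 else 0 with hD
  obtain ⟨u, hu, hug⟩ := exists_nonneg_transpose_mulVec_eq (D * H) (C *ᵥ x + Cᵀ *ᵥ x + c) (by
    intro h hh
    have hmem : ∀ᶠ t : ℝ in 𝓝[>] 0, x + t • h ∈ lowerPolyhedron H b := by
      refine eventually_all.2 fun k => ?_
      rcases (hxP k).eq_or_lt with hk | hk
      · filter_upwards [self_mem_nhdsWithin] with t ht
        have h1 := hh k
        rw [← Matrix.mulVec_mulVec, hD, Matrix.mulVec_diagonal, if_pos hk.symm, one_mul] at h1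
        have := mul_nonneg (le_of_lt ht) h1
        simp only [Matrix.mulVec_add, Matrix.mulVec_smul, Pi.add_apply, Pi.smul_apply, smul_eq_mul]
        linarith
      · have hc : Continuous fun t : ℝ => (H *ᵥ (x + t • h)) k := by fun_prop
        have := (hc.tendsto 0).mono_left (nhdsWithin_le_nhds (s := Set.Ioi 0))
        simp only [zero_smul, add_zero] at this
        exact (this.eventually_const_lt hk).mono fun _ => le_of_lt
    have hc : Continuous fun t : ℝ => (C *ᵥ x + Cᵀ *ᵥ x + c) ⬝ᵥ h + t * (h ⬝ᵥ (C *ᵥ h)) := by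
      fun_prop
    have ht := (hc.tendsto 0).mono_left (nhdsWithin_le_nhds (s := Set.Ioi 0))
    simp only [zero_mul, add_zero] at ht
    refine ge_of_tendsto ht ?_
    filter_upwards [hmem, self_mem_nhdsWithin] with t hP ht0
    have h1 := hx _ hP
    rw [quadFun_add_smul] at h1
    have ht0 : 0 < t := ht0
    refine nonneg_of_mul_nonneg_right (a := t) ?_ ht0
    linarith)
  refine ⟨D *ᵥ u, fun k => ?_, fun k => ?_, ?_⟩
  · rw [hD, Matrix.mulVec_diagonal]
    split_ifs <;> simp [hu k]
  · rw [hD, Matrix.mulVec_diagonal]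
    split_ifs with h <;> simp [h]
  · rw [← hug, Matrix.transpose_mul, hD, Matrix.diagonal_transpose, Matrix.mulVec_mulVec]

end Cones

/-! ### Convexity of the complementary range -/

section ComplementaryRange

variable {n : ℕ}

lemma augMatrix_mulVec (M : Matrix (Fin n) (Fin n) ℝ) (x : Fin n ⊕ Fin n → ℝ) :
    augMatrix M *ᵥ x = x ∘ Sum.inl - M *ᵥ (x ∘ Sum.inr) := by
  rw [augMatrix, Matrix.fromCols_mulVec, Matrix.one_mulVec, Matrix.neg_mulVec, sub_eq_add_neg]

/-- For a row sufficient matrix, every feasible linear complementarity problem is solvable. -/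
theorem complementaryRange_eq_cone {M : Matrix (Fin n) (Fin n) ℝ} (hM : IsColumnSufficient Mᵀ) :
    complementaryRange M = cone (augMatrix M) := by
  refine Set.Subset.antisymm ?_ ?_
  · rintro y ⟨w, z, hy, hw, hz, -⟩
    refine ⟨Sum.elim w z, fun k => ?_, ?_⟩
    · cases k <;> simp [hw, hz]
    · rw [augMatrix_mulVec, ← hy]; rfl
  · rintro y ⟨x, hx, hxy⟩
    rw [augMatrix_mulVec] at hxy
    let H := Matrix.fromRows (1 : Matrix (Fin n) (Fin n) ℝ) M
    have hP : ∀ z : Fin n → ℝ, z ∈ lowerPolyhedron H (Sum.elim 0 (-y)) ↔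
        (∀ i, 0 ≤ z i) ∧ ∀ i, 0 ≤ (y + M *ᵥ z) i := fun z => by
      simp [H, lowerPolyhedron, Matrix.fromRows_mulVec, neg_le_iff_add_nonneg']
    have hf : ∀ z, quadFun M y z = ∑ i, z i * (y + M *ᵥ z) i := fun z => by
      rw [quadFun, dotProduct_comm y z, ← dotProduct_add, add_comm (M *ᵥ z)]; rfl
    obtain ⟨z, hzP, hz⟩ := exists_forall_quadFun_le M y H (Sum.elim 0 (-y))
      ⟨x ∘ Sum.inr, (hP _).2 ⟨fun i => hx _, fun i => by rw [← hxy]; simpa using hx _⟩⟩ 0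
      fun z hz => by
        rw [hf]
        exact Finset.sum_nonneg fun i _ => mul_nonneg (((hP z).1 hz).1 i) (((hP z).1 hz).2 i)
    obtain ⟨u, hu, hslack, hgrad⟩ := exists_kkt_multiplier M y _ _ hzP hz
    obtain ⟨hz0, hw0⟩ := (hP z).1 hzP
    set w := y + M *ᵥ z with hw
    have hv : ∀ i, u (Sum.inl i) * z i = 0 := fun i => by
      simpa [H, Matrix.fromRows_mulVec] using hslack (Sum.inl i)
    have hu' : ∀ i, u (Sum.inr i) * w i = 0 := fun i => by
      simpa [H, Matrix.fromRows_mulVec, hw, add_comm] using hslack (Sum.inr i)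
    -- Stationarity rearranged. With slackness, the products tested by sufficiency of `Mᵀ` are minus
    -- sums of nonnegative terms, one of them `z i * w i`.
    have hr : Mᵀ *ᵥ (z - u ∘ Sum.inr) = u ∘ Sum.inl - w := by
      rw [Matrix.transpose_fromRows, Matrix.fromCols_mulVec, Matrix.transpose_one,
        Matrix.one_mulVec] at hgrad
      rw [Matrix.mulVec_sub, hw, sub_eq_sub_iff_add_eq_add, hgrad]
      abel
    have hprod : ∀ i, (z - u ∘ Sum.inr) i * (Mᵀ *ᵥ (z - u ∘ Sum.inr)) i =
        -(z i * w i) - u (Sum.inr i) * u (Sum.inl i) := fun i => by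
      rw [hr]
      simp only [Pi.sub_apply, Function.comp]
      linear_combination hv i + hu' i
    have hzero := hM (z - u ∘ Sum.inr) fun i => by
      rw [hprod]
      linarith [mul_nonneg (hz0 i) (hw0 i), mul_nonneg (hu (Sum.inr i)) (hu (Sum.inl i))]
    refine ⟨w, z, by rw [hw]; abel, hw0, hz0, Finset.sum_eq_zero fun i _ => ?_⟩
    have := hzero i
    rw [hprod] at this
    linarith [mul_nonneg (hz0 i) (hw0 i), mul_nonneg (hu (Sum.inr i)) (hu (Sum.inl i)),
      mul_comm (z i) (w i)]

/-- Absorbing `p` into `w` keeps feasibility but may lose complementarity; feasibility is enough. -/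
lemma add_mem_complementaryRange {M : Matrix (Fin n) (Fin n) ℝ} (hM : IsColumnSufficient Mᵀ)
    {y p : Fin n → ℝ} (hy : y ∈ complementaryRange M) (hp : ∀ i, 0 ≤ p i) :
    y + p ∈ complementaryRange M := by
  obtain ⟨w, z, rfl, hw, hz, -⟩ := hy
  rw [complementaryRange_eq_cone hM]
  refine ⟨Sum.elim (w + p) z, fun k => ?_, ?_⟩
  · cases k with
    | inl i => simpa using add_nonneg (hw i) (hp i)
    | inr i => simpa using hz i
  · rw [augMatrix_mulVec, Sum.elim_comp_inl, Sum.elim_comp_inr]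
    abel

end ComplementaryRange

/-! ### Finite closed covers and recurring values -/

section Topology

lemma interior_biUnion_eq_empty {X ι : Type*} [TopologicalSpace X] (s : Finset ι) (D : ι → Set X)
    (hD : ∀ i ∈ s, IsClosed (D i)) (h : ∀ i ∈ s, interior (D i) = ∅) :
    interior (⋃ i ∈ s, D i) = ∅ := by
  classical
  induction s using Finset.induction_on with
  | empty => simp
  | insert a s _ ih =>
    rw [Finset.set_biUnion_insert,
      interior_union_isClosed_of_interior_empty (hD a (Finset.mem_insert_self _ _))
        (ih (fun i hi => hD i (Finset.mem_insert_of_mem hi))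
          fun i hi => h i (Finset.mem_insert_of_mem hi))]
    exact h a (Finset.mem_insert_self _ _)

/-- In a finite closed cover of an open set, the members with empty interior are superfluous. -/
lemma exists_mem_interior_nonempty {X ι : Type*} [TopologicalSpace X] [Finite ι] {D : ι → Set X}
    {p : ι → Prop} (hD : ∀ i, IsClosed (D i)) {U : Set X} (hU : IsOpen U)
    (hUD : ∀ x ∈ U, ∃ i, p i ∧ x ∈ D i) {x : X} (hx : x ∈ U) :
    ∃ i, p i ∧ x ∈ D i ∧ (interior (D i)).Nonempty := by
  classical
  have := Fintype.ofFinite ι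
  by_contra! hcon
  set G : Set X := ⋃ i ∈ {i | p i ∧ (interior (D i)).Nonempty}, D i
  have hG : IsClosed G := (Set.toFinite _).isClosed_biUnion fun i _ => hD i
  have hxG : x ∉ G := by
    simp only [G, Set.mem_iUnion, not_exists]
    rintro i ⟨hp, hi⟩ hxi
    exact hi.ne_empty (hcon i hp hxi)
  have hsub : U \ G ⊆ interior (⋃ i ∈ Finset.univ.filter fun i => interior (D i) = ∅, D i) := by
    refine interior_maximal ?_ (hU.sdiff hG)
    rintro y ⟨hy, hyG⟩
    obtain ⟨i, hp, hi⟩ := hUD y hy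
    refine Set.mem_biUnion (x := i) ?_ hi
    simp only [Finset.coe_filter, Finset.mem_univ, true_and, Set.mem_ofPred_eq]
    by_contra hne
    exact hyG (Set.mem_biUnion (x := i) ⟨hp, Set.nonempty_iff_ne_empty.2 hne⟩ hi)
  rw [interior_biUnion_eq_empty _ _ (fun i _ => hD i) (by simp)] at hsub
  exact hsub ⟨hx, hxG⟩

/-- A function into a finite type eventually takes only values that it takes frequently. -/
lemma eventually_frequently_eq {α β : Type*} [Finite β] (l : Filter α) (f : α → β) :
    ∀ᶠ a in l, ∃ᶠ a' in l, f a' = f a := by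
  have h : ∀ b, ∀ᶠ a in l, f a = b → ∃ᶠ a' in l, f a' = b := fun b => by
    by_cases hb : ∃ᶠ a' in l, f a' = b
    · exact Eventually.of_forall fun _ _ => hb
    · exact (not_frequently.1 hb).mono fun a ha h => absurd h ha
  exact (eventually_all.2 h).mono fun a ha => ha _ rfl

end Topology

/-! ### Dimension measured in parameter space -/

section Dimension

variable {n d : ℕ} (q : Fin n → ℝ) (Q : Matrix (Fin n) (Fin d) ℝ)

/-- The parameters `θ` for which `q + Q θ` lies in `C`. -/
def paramSet (C : Set (Fin n → ℝ)) : Set (Fin d → ℝ) := {θ | q + Q *ᵥ θ ∈ C}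

/-- The parametrization `θ ↦ q + Q θ` of `affineSpace q Q`. -/
def paramMap : (Fin d → ℝ) →ᵃ[ℝ] (Fin n → ℝ) :=
  AffineMap.const ℝ _ q + Q.mulVecLin.toAffineMap

lemma continuous_paramMap : Continuous (paramMap q Q) := by
  have : Continuous fun θ : Fin d → ℝ => q + Q *ᵥ θ := by fun_prop
  exact this

lemma paramMap_image_paramSet (C : Set (Fin n → ℝ)) :
    paramMap q Q '' paramSet q Q C = C ∩ affineSpace q Q := by
  ext y
  constructor
  · rintro ⟨θ, hθ, rfl⟩
    exact ⟨hθ, θ, rfl⟩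
  · rintro ⟨hy, θ, rfl⟩
    exact ⟨θ, hy, rfl⟩

lemma convex_paramSet {C : Set (Fin n → ℝ)} (hC : Convex ℝ C) : Convex ℝ (paramSet q Q C) :=
  hC.affine_preimage (paramMap q Q)

lemma isClosed_paramSet {C : Set (Fin n → ℝ)} (hC : IsClosed C) : IsClosed (paramSet q Q C) :=
  hC.preimage (continuous_paramMap q Q)

lemma affDim_le (D : Set (Fin d → ℝ)) : affDim D ≤ (d : WithBot ℕ) := by
  unfold affDim
  split_ifs
  · exact_mod_cast (Submodule.finrank_le _).trans (by simp)
  · exact bot_le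

lemma affDim_eq_iff {D : Set (Fin d → ℝ)} (hD : Convex ℝ D) :
    affDim D = (d : WithBot ℕ) ↔ (interior D).Nonempty := by
  rw [hD.interior_nonempty_iff_affineSpan_eq_top]
  unfold affDim
  split_ifs with h
  · rw [AffineSubspace.affineSpan_eq_top_iff_vectorSpan_eq_top_of_nonempty ℝ _ _ h]
    constructor
    · intro hd
      refine Submodule.eq_top_of_finrank_eq ?_
      rw [Module.finrank_fin_fun]
      exact_mod_cast hd
    · intro hd
      rw [hd, finrank_top, Module.finrank_fin_fun]
  · rw [Set.not_nonempty_iff_eq_empty.1 h]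
    simp

variable {q Q}

lemma mulVec_injective_of_rank_eq {κ : Type*} [Fintype κ] {T : Matrix (Fin n) κ ℝ}
    (hT : T.rank = Fintype.card κ) : Function.Injective T.mulVecLin := by
  rw [← LinearMap.ker_eq_bot, ← Submodule.finrank_eq_zero]
  have h := T.mulVecLin.finrank_range_add_finrank_ker
  rw [Module.finrank_fintype_fun_eq_card] at h
  unfold Matrix.rank at hT
  omega

variable (q) in
lemma affDim_inter_affineSpace (hQ : Q.rank = d) (C : Set (Fin n → ℝ)) :
    affDim (C ∩ affineSpace q Q) = affDim (paramSet q Q C) := by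
  have hinj : Function.Injective (paramMap q Q).linear := by
    simpa [paramMap] using mulVec_injective_of_rank_eq (T := Q) (by simpa using hQ)
  rw [← paramMap_image_paramSet, affDim, affDim, Set.image_nonempty,
    ← AffineMap.map_vectorSpan,
    ← (Submodule.equivMapOfInjective _ hinj _).finrank_eq]

lemma affDim_inter_affineSpace_eq_iff (hQ : Q.rank = d) {C : Set (Fin n → ℝ)} (hC : Convex ℝ C) :
    affDim (C ∩ affineSpace q Q) = (d : WithBot ℕ) ↔ (interior (paramSet q Q C)).Nonempty := by
  rw [affDim_inter_affineSpace q hQ, affDim_eq_iff (convex_paramSet q Q hC)]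

/-- Full dimension puts the whole image of `paramMap` inside the affine span, so relatively open
sets pull back to open sets of parameters. -/
lemma exists_mem_interior_of_mem_intrinsicInterior (hQ : Q.rank = d) {C : Set (Fin n → ℝ)}
    (hC : Convex ℝ C) (hdim : affDim (C ∩ affineSpace q Q) = (d : WithBot ℕ)) {y : Fin n → ℝ}
    (hy : y ∈ intrinsicInterior ℝ (C ∩ affineSpace q Q)) :
    ∃ θ ∈ interior (paramSet q Q C), paramMap q Q θ = y := by
  have hspan : affineSpan ℝ (paramSet q Q C) = ⊤ := by
    rw [← (convex_paramSet q Q hC).interior_nonempty_iff_affineSpan_eq_top,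
      ← affDim_inter_affineSpace_eq_iff hQ hC, hdim]
  have hmem : ∀ θ, paramMap q Q θ ∈ affineSpan ℝ (C ∩ affineSpace q Q) := fun θ => by
    rw [← paramMap_image_paramSet, ← AffineSubspace.map_span, hspan]
    exact AffineSubspace.mem_map_of_mem _ (AffineSubspace.mem_top _ _ _)
  obtain ⟨θ, rfl⟩ := (intrinsicInterior_subset hy).2
  obtain ⟨z, hz, hzy⟩ := mem_intrinsicInterior.1 hy
  let g : (Fin d → ℝ) → affineSpan ℝ (C ∩ affineSpace q Q) := fun θ => ⟨paramMap q Q θ, hmem θ⟩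
  have hg : Continuous g := (continuous_paramMap q Q).subtype_mk hmem
  refine ⟨θ, ?_, rfl⟩
  have hsub : g ⁻¹' interior (Subtype.val ⁻¹' (C ∩ affineSpace q Q)) ⊆ paramSet q Q C :=
    fun θ' hθ' => (interior_subset (Set.mem_preimage.1 hθ')).1
  refine interior_maximal hsub (isOpen_interior.preimage hg) ?_
  have : g θ = z := Subtype.ext hzy.symm
  rwa [Set.mem_preimage, this]

end Dimension

/-! ### Polyhedrality -/

section Polyhedra

variable {n d : ℕ}

lemma isPolyhedron_of_linearMap {κ : Type*} [Fintype κ] (L : (Fin n → ℝ) →ₗ[ℝ] (κ → ℝ))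
    (b : κ → ℝ) : IsPolyhedron {y | ∀ k, L y k ≤ b k} := by
  classical
  let e := (Fintype.equivFin κ).symm
  refine ⟨Fintype.card κ, (LinearMap.toMatrix' L).submatrix e id, b ∘ e, ?_⟩
  have h : ∀ y k, ((LinearMap.toMatrix' L).submatrix e id *ᵥ y) k = L y (e k) := fun y k => by
    rw [← LinearMap.toMatrix'_mulVec L y]; rfl
  ext y
  simp only [Set.mem_ofPred_eq, h, Function.comp]
  exact ⟨fun hy k => hy _, fun hy k => by simpa using hy (e.symm k)⟩

lemma IsPolyhedron.inter {P P' : Set (Fin n → ℝ)} (h : IsPolyhedron P) (h' : IsPolyhedron P') :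
    IsPolyhedron (P ∩ P') := by
  obtain ⟨m, H, b, rfl⟩ := h
  obtain ⟨m', H', b', rfl⟩ := h'
  convert isPolyhedron_of_linearMap (Matrix.fromRows H H').mulVecLin (Sum.elim b b') using 1
  ext y
  simp [Matrix.fromRows_mulVec]

lemma isPolyhedron_affineSpace (q : Fin n → ℝ) {Q : Matrix (Fin n) (Fin d) ℝ} (hQ : Q.rank = d) :
    IsPolyhedron (affineSpace q Q) := by
  obtain ⟨P, hP⟩ := Q.mulVecLin.exists_leftInverse_of_injective
    (LinearMap.ker_eq_bot.2 (mulVec_injective_of_rank_eq (by simpa using hQ)))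
  have hP : ∀ θ, P (Q *ᵥ θ) = θ := fun θ => LinearMap.congr_fun hP θ
  -- The kernel of `L` is the range of `Q`, so `S` is cut out by `L y = L q`, written as two systems
  -- of inequalities.
  let L : (Fin n → ℝ) →ₗ[ℝ] (Fin n → ℝ) := LinearMap.id - Q.mulVecLin ∘ₗ P
  have hL : ∀ y, L y = y - Q *ᵥ P y := fun y => rfl
  have h := (isPolyhedron_of_linearMap L (L q)).inter (isPolyhedron_of_linearMap (-L) (-L q))
  convert h using 1
  ext y
  have : y ∈ affineSpace q Q ↔ L y = L q := by
    constructor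
    · rintro ⟨θ, rfl⟩
      rw [map_add, add_eq_left, hL, hP, sub_self]
    · intro hy
      refine ⟨P (y - q), ?_⟩
      rw [hL, hL] at hy
      rw [map_sub, Matrix.mulVec_sub]
      rw [sub_eq_iff_eq_add] at hy
      nth_rewrite 1 [hy]
      abel
  rw [this]
  simp only [Set.mem_inter_iff, Set.mem_ofPred_eq, LinearMap.neg_apply, Pi.neg_apply, neg_le_neg_iff]
  exact ⟨fun h => by simp [h], fun h => funext fun i => le_antisymm (h.1 i) (h.2 i)⟩

end Polyhedra

/-! ### Complementary cones and bases -/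

section ComplementaryCones

variable {n d : ℕ} {M : Matrix (Fin n) (Fin n) ℝ} {J B : Finset (Fin n ⊕ Fin n)}

lemma colSubmatrix_mulVec_restrict {x : Fin n ⊕ Fin n → ℝ} (hx : ∀ k ∉ J, x k = 0) :
    colSubmatrix M J *ᵥ (fun k => x k) = augMatrix M *ᵥ x := by
  ext i
  change ∑ k : J, augMatrix M i k * x k = ∑ k, augMatrix M i k * x k
  rw [Finset.sum_coe_sort J fun k => augMatrix M i k * x k]
  exact Finset.sum_subset (Finset.subset_univ _) fun k _ hk => by rw [hx k hk, mul_zero]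

/-- Extension by zero lets solutions for different index sets be compared in one space. -/
lemma mem_complementaryCone_iff {y : Fin n → ℝ} :
    y ∈ complementaryCone M J ↔
      ∃ x : Fin n ⊕ Fin n → ℝ, (∀ k, 0 ≤ x k) ∧ (∀ k ∉ J, x k = 0) ∧ augMatrix M *ᵥ x = y := by
  classical
  constructor
  · rintro ⟨u, hu, rfl⟩
    have hx : ∀ k ∉ J, (fun k => if h : k ∈ J then u ⟨k, h⟩ else 0) k = 0 := fun k hk => by simp [hk]
    refine ⟨fun k => if h : k ∈ J then u ⟨k, h⟩ else 0, fun k => ?_, hx, ?_⟩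
    · dsimp only
      split_ifs
      exacts [hu _, le_rfl]
    · rw [← colSubmatrix_mulVec_restrict hx]
      simp
  · rintro ⟨x, hx0, hx, rfl⟩
    exact ⟨fun k => x k, fun k => hx0 _, colSubmatrix_mulVec_restrict hx⟩

lemma isClosed_complementaryCone : IsClosed (complementaryCone M J) := isClosed_cone _

lemma convex_complementaryCone : Convex ℝ (complementaryCone M J) := convex_cone _

/-- The span of the columns of `A_J`. -/
def colSpan (M : Matrix (Fin n) (Fin n) ℝ) (J : Finset (Fin n ⊕ Fin n)) :
    Submodule ℝ (Fin n → ℝ) := LinearMap.range (colSubmatrix M J).mulVecLin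

lemma mulVec_mem_colSpan {x : Fin n ⊕ Fin n → ℝ} (hx : ∀ k ∉ J, x k = 0) :
    augMatrix M *ᵥ x ∈ colSpan M J := ⟨fun k => x k, colSubmatrix_mulVec_restrict hx⟩

lemma complementaryCone_subset_colSpan : complementaryCone M J ⊆ colSpan M J := by
  rintro _ ⟨u, -, rfl⟩
  exact ⟨u, rfl⟩

lemma rank_colSubmatrix_of_colSpan_eq_top (h : colSpan M J = ⊤) : (colSubmatrix M J).rank = n := by
  change Module.finrank ℝ (colSpan M J) = n
  rw [h, finrank_top, Module.finrank_fin_fun]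

lemma le_card_of_colSpan_eq_top (h : colSpan M J = ⊤) : n ≤ J.card := by
  have := (colSubmatrix M J).rank_le_card_width
  rwa [rank_colSubmatrix_of_colSpan_eq_top h, Fintype.card_coe] at this

lemma IsComplementaryBasis.mulVecLin_injective (hB : IsComplementaryBasis M B) :
    Function.Injective (colSubmatrix M B).mulVecLin :=
  mulVec_injective_of_rank_eq (by rw [hB.2.1, Fintype.card_coe, hB.1])

lemma IsComplementaryBasis.mulVecLin_surjective (hB : IsComplementaryBasis M B) :
    Function.Surjective (colSubmatrix M B).mulVecLin := by
  rw [← LinearMap.range_eq_top]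
  refine Submodule.eq_top_of_finrank_eq ?_
  rw [Module.finrank_fin_fun]
  exact hB.2.1

lemma IsComplementaryBasis.eq_of_mulVec_eq (hB : IsComplementaryBasis M B)
    {x x' : Fin n ⊕ Fin n → ℝ} (hx : ∀ k ∉ B, x k = 0) (hx' : ∀ k ∉ B, x' k = 0)
    (h : augMatrix M *ᵥ x = augMatrix M *ᵥ x') : x = x' := by
  rw [← colSubmatrix_mulVec_restrict hx, ← colSubmatrix_mulVec_restrict hx'] at h
  have := hB.mulVecLin_injective h
  ext k
  by_cases hk : k ∈ B
  · exact congrFun this ⟨k, hk⟩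
  · rw [hx k hk, hx' k hk]

lemma IsComplementaryBasis.isPolyhedron_complementaryCone (hB : IsComplementaryBasis M B) :
    IsPolyhedron (complementaryCone M B) := by
  let G := LinearEquiv.ofBijective _ ⟨hB.mulVecLin_injective, hB.mulVecLin_surjective⟩
  convert isPolyhedron_of_linearMap (-G.symm.toLinearMap) 0 using 1
  ext y
  have : y ∈ complementaryCone M B ↔ ∀ k, 0 ≤ G.symm y k := by
    constructor
    · rintro ⟨u, hu, hy⟩
      have : G.symm y = u := by rw [LinearEquiv.symm_apply_eq]; exact hy.symm
      rwa [this]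
    · exact fun h => ⟨G.symm y, h, G.apply_symm_apply y⟩
  simp [this]

lemma complementaryCone_subset_complementaryRange (hJ : ∀ i, Xor (Sum.inl i ∈ J) (Sum.inr i ∈ J)) :
    complementaryCone M J ⊆ complementaryRange M := by
  intro y hy
  obtain ⟨x, hx0, hx, rfl⟩ := mem_complementaryCone_iff.1 hy
  refine ⟨x ∘ Sum.inl, x ∘ Sum.inr, (augMatrix_mulVec M x).symm, fun i => hx0 _, fun i => hx0 _,
    Finset.sum_eq_zero fun i _ => ?_⟩
  rcases hJ i with h | h
  · simp [hx _ h.2]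
  · simp [hx _ h.2]

lemma exists_mem_complementaryCone {y : Fin n → ℝ} (hy : y ∈ complementaryRange M) :
    ∃ J : Finset (Fin n ⊕ Fin n), (J.card = n ∧ ∀ i, Xor (Sum.inl i ∈ J) (Sum.inr i ∈ J)) ∧
      y ∈ complementaryCone M J := by
  classical
  obtain ⟨w, z, rfl, hw, hz, hwz⟩ := hy
  have hwz' : ∀ i, w i * z i = 0 := fun i =>
    (Finset.sum_eq_zero_iff_of_nonneg fun i _ => mul_nonneg (hw i) (hz i)).1 hwz i
      (Finset.mem_univ i)
  let f : Fin n → Fin n ⊕ Fin n := fun i => if z i = 0 then Sum.inl i else Sum.inr i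
  have hf : Function.Injective f := fun i j hij => by
    simp only [f] at hij
    split_ifs at hij <;> simp_all
  have hl : ∀ i, Sum.inl i ∈ Finset.univ.image f ↔ z i = 0 := fun i => by
    simp only [Finset.mem_image, Finset.mem_univ, true_and, f]
    constructor
    · rintro ⟨j, hj⟩
      split_ifs at hj with h
      all_goals simp_all
    · exact fun h => ⟨i, if_pos h⟩
  have hr : ∀ i, Sum.inr i ∈ Finset.univ.image f ↔ z i ≠ 0 := fun i => by
    simp only [Finset.mem_image, Finset.mem_univ, true_and, f]
    constructor
    · rintro ⟨j, hj⟩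
      split_ifs at hj with h
      all_goals simp_all
    · exact fun h => ⟨i, if_neg h⟩
  refine ⟨Finset.univ.image f, ⟨by rw [Finset.card_image_of_injective _ hf]; simp, fun i => ?_⟩,
    mem_complementaryCone_iff.2 ⟨Sum.elim w z, fun k => ?_, fun k hk => ?_, ?_⟩⟩
  · rw [hl, hr]
    by_cases h : z i = 0 <;> simp [Xor, h]
  · cases k <;> simp [hw, hz]
  · cases k with
    | inl i =>
      rw [hl] at hk
      simpa [hk] using hwz' i
    | inr i =>
      rw [hr, not_not] at hk
      exact hk
  · rw [augMatrix_mulVec]; rfl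

/-- Nondegenerate complementary solutions for different complementary index sets have different
right-hand sides. -/
lemma eq_of_pos_of_mulVec_eq (hM : IsColumnSufficient M) {B' : Finset (Fin n ⊕ Fin n)}
    (hB : ∀ i, Xor (Sum.inl i ∈ B) (Sum.inr i ∈ B))
    (hB' : ∀ i, Xor (Sum.inl i ∈ B') (Sum.inr i ∈ B')) {a b : Fin n ⊕ Fin n → ℝ}
    (ha : ∀ k ∈ B, 0 < a k) (ha0 : ∀ k ∉ B, a k = 0) (hb : ∀ k ∈ B', 0 < b k)
    (hb0 : ∀ k ∉ B', b k = 0) (h : augMatrix M *ᵥ a = augMatrix M *ᵥ b) : B = B' := by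
  rw [augMatrix_mulVec, augMatrix_mulVec] at h
  have han : ∀ k, 0 ≤ a k := fun k => by
    by_cases hk : k ∈ B
    exacts [(ha k hk).le, (ha0 k hk).ge]
  have hbn : ∀ k, 0 ≤ b k := fun k => by
    by_cases hk : k ∈ B'
    exacts [(hb k hk).le, (hb0 k hk).ge]
  have hcomp : ∀ i, a (Sum.inl i) * a (Sum.inr i) = 0 := fun i => by
    rcases hB i with h | h <;> simp [ha0 _ h.2]
  have hcomp' : ∀ i, b (Sum.inl i) * b (Sum.inr i) = 0 := fun i => by
    rcases hB' i with h | h <;> simp [hb0 _ h.2]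
  have hMz : M *ᵥ (a ∘ Sum.inr - b ∘ Sum.inr) = a ∘ Sum.inl - b ∘ Sum.inl := by
    rw [Matrix.mulVec_sub]
    rw [sub_eq_sub_iff_add_eq_add] at h ⊢
    rw [add_comm, ← h, add_comm]
  -- Sufficiency makes both cross products vanish; by positivity `B` and `B'` never make opposite
  -- choices at `i`.
  have hprod : ∀ i, (a ∘ Sum.inr - b ∘ Sum.inr) i * (M *ᵥ (a ∘ Sum.inr - b ∘ Sum.inr)) i =
      -(a (Sum.inr i) * b (Sum.inl i)) - a (Sum.inl i) * b (Sum.inr i) := fun i => by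
    rw [hMz]
    simp only [Pi.sub_apply, Function.comp]
    linear_combination hcomp i + hcomp' i
  have h1 : ∀ i, 0 ≤ a (Sum.inr i) * b (Sum.inl i) := fun i => mul_nonneg (han _) (hbn _)
  have h2 : ∀ i, 0 ≤ a (Sum.inl i) * b (Sum.inr i) := fun i => mul_nonneg (han _) (hbn _)
  have hzero := hM _ fun i => by rw [hprod]; linarith [h1 i, h2 i]
  simp only [hprod] at hzero
  have hlr : ∀ i, Sum.inl i ∈ B → Sum.inr i ∉ B' := fun i hi hi' => by
    linarith [hzero i, h1 i, mul_pos (ha _ hi) (hb _ hi')]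
  have hrl : ∀ i, Sum.inr i ∈ B → Sum.inl i ∉ B' := fun i hi hi' => by
    linarith [hzero i, h2 i, mul_pos (ha _ hi) (hb _ hi')]
  ext k
  cases k with
  | inl i => have := hB i; have := hB' i; have := hlr i; have := hrl i; simp only [Xor] at *; tauto
  | inr i => have := hB i; have := hB' i; have := hlr i; have := hrl i; simp only [Xor] at *; tauto

end ComplementaryCones

/-! ### Generic perturbation of the right-hand side -/

section Perturbation

variable {n d : ℕ}

lemma tendsto_add_lexVector (q : Fin n → ℝ) :
    Tendsto (fun ε => q + lexVector n ε) (𝓝[>] 0) (𝓝 q) := by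
  have hc : Continuous fun ε => q + lexVector n ε :=
    continuous_const.add (continuous_pi fun i => continuous_pow _)
  have h := (hc.tendsto 0).mono_left (nhdsWithin_le_nhds (s := Set.Ioi 0))
  have h0 : lexVector n 0 = 0 := funext fun i => zero_pow (Nat.succ_ne_zero _)
  rwa [h0, add_zero] at h

lemma lexVector_pos {ε : ℝ} (hε : 0 < ε) (i : Fin n) : 0 < lexVector n ε i := pow_pos hε _

lemma eventually_eval_ne_zero {p : Polynomial ℝ} (hp : p ≠ 0) :
    ∀ᶠ ε : ℝ in 𝓝[>] 0, p.eval ε ≠ 0 := by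
  have hfin : ({x | p.IsRoot x} \ {0}).Finite := (Polynomial.finite_setOfPred_isRoot hp).sdiff
  have h0 : ({x | p.IsRoot x} \ {0})ᶜ ∈ 𝓝 (0 : ℝ) := hfin.isClosed.isOpen_compl.mem_nhds (by simp)
  filter_upwards [mem_nhdsWithin_of_mem_nhds h0, self_mem_nhdsWithin] with ε hε hε0 hroot
  exact hε ⟨hroot, ne_of_gt hε0⟩

/-- A nonzero functional vanishing on `W` takes on `q + lexVector n ε` the values of a polynomial in
`ε`. Distinct powers keep its coefficients separate, so the polynomial is nonzero and has finitely
many roots. -/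
lemma eventually_add_lexVector_notMem (q : Fin n → ℝ) {W : Submodule ℝ (Fin n → ℝ)} (hW : W ≠ ⊤) :
    ∀ᶠ ε : ℝ in 𝓝[>] 0, q + lexVector n ε ∉ W := by
  obtain ⟨f, hf, hWf⟩ := W.exists_le_ker_of_lt_top hW.lt_top
  let p : Polynomial ℝ := Polynomial.C (f q) +
    ∑ i : Fin n, Polynomial.monomial ((i : ℕ) + 1) (f (Pi.single i 1))
  have heval : ∀ ε, p.eval ε = f (q + lexVector n ε) := fun ε => by
    conv_rhs => rw [map_add, ← Finset.univ_sum_single (lexVector n ε), map_sum]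
    simp only [p, Polynomial.eval_add, Polynomial.eval_C, Polynomial.eval_finsetSum,
      Polynomial.eval_monomial]
    congr 1
    refine Finset.sum_congr rfl fun i _ => ?_
    rw [mul_comm, ← smul_eq_mul, ← map_smul, ← Pi.single_smul, smul_eq_mul, mul_one]
    rfl
  have hp : p ≠ 0 := by
    intro hp
    refine hf (LinearMap.pi_ext' fun i => LinearMap.ext_ring ?_)
    have := congrArg (Polynomial.coeff · ((i : ℕ) + 1)) hp
    simpa [p, Polynomial.coeff_C, Polynomial.coeff_monomial, Fin.val_inj] using this
  filter_upwards [eventually_eval_ne_zero hp] with ε hε hmem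
  exact hε ((heval ε).trans (hWf hmem))

lemma eventually_colSpan_eq_top (M : Matrix (Fin n) (Fin n) ℝ) (q : Fin n → ℝ) :
    ∀ᶠ ε : ℝ in 𝓝[>] 0, ∀ J, q + lexVector n ε ∈ colSpan M J → colSpan M J = ⊤ := by
  refine eventually_all.2 fun J => ?_
  by_cases h : colSpan M J = ⊤
  · exact Eventually.of_forall fun _ _ => h
  · exact (eventually_add_lexVector_notMem q h).mono fun ε hε hmem => absurd hmem hε

variable {M : Matrix (Fin n) (Fin n) ℝ} {q : Fin n → ℝ} {Q : Matrix (Fin n) (Fin d) ℝ}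
  {B : Finset (Fin n ⊕ Fin n)}

lemma tendsto_add_smul_nhds (θ η : Fin d → ℝ) :
    Tendsto (fun s : ℝ => θ + s • η) (𝓝[>] 0) (𝓝 θ) := by
  have hc : Continuous fun s : ℝ => θ + s • η := by fun_prop
  have := (hc.tendsto 0).mono_left (nhdsWithin_le_nhds (s := Set.Ioi 0))
  rwa [zero_smul, add_zero] at this

/-- Stretching `θ` by `1 + s` scales only the `Q` part, so a linear combination of two points of `W`
isolates `s • q`. -/
lemma mem_of_eventually_add_mulVec_mem {W : Submodule ℝ (Fin n → ℝ)} {θ : Fin d → ℝ}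
    (h : ∀ᶠ θ' in 𝓝 θ, q + Q *ᵥ θ' ∈ W) : q ∈ W := by
  obtain ⟨s, hs, hs0⟩ := (((tendsto_add_smul_nhds θ θ).eventually h).and
    self_mem_nhdsWithin).exists
  have hs0 : 0 < s := hs0
  have h1 := W.sub_mem (W.smul_mem (1 + s) h.self_of_nhds) hs
  have h2 : (1 + s) • (q + Q *ᵥ θ) - (q + Q *ᵥ (θ + s • θ)) = s • q := by
    rw [Matrix.mulVec_add, Matrix.mulVec_smul]
    module
  rw [h2] at h1
  exact (W.smul_mem_iff hs0.ne').1 h1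

lemma colSpan_eq_top_of_interior_nonempty
    (hgen : ∀ J, q ∈ colSpan M J → colSpan M J = ⊤)
    (h : (interior (paramSet q Q (complementaryCone M B))).Nonempty) : colSpan M B = ⊤ := by
  obtain ⟨θ, hθ⟩ := h
  refine hgen B (mem_of_eventually_add_mulVec_mem (Q := Q) (θ := θ) ?_)
  filter_upwards [mem_interior_iff_mem_nhds.1 hθ] with θ' hθ'
  exact complementaryCone_subset_colSpan hθ'

/-- For generic `q`, the basic solutions at interior points of a critical domain are
nondegenerate. -/
lemma exists_pos_of_mem_interior (hgen : ∀ J, q ∈ colSpan M J → colSpan M J = ⊤)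
    (hB : IsComplementaryBasis M B) {θ : Fin d → ℝ}
    (hθ : θ ∈ interior (paramSet q Q (complementaryCone M B))) :
    ∃ x : Fin n ⊕ Fin n → ℝ, (∀ k ∈ B, 0 < x k) ∧ (∀ k ∉ B, x k = 0) ∧
      augMatrix M *ᵥ x = q + Q *ᵥ θ := by
  classical
  have hθD : θ ∈ paramSet q Q (complementaryCone M B) := interior_subset hθ
  obtain ⟨x, hx0, hx, hxy⟩ := mem_complementaryCone_iff.1 hθD
  refine ⟨x, fun k hk => (hx0 k).lt_of_ne' fun hxk => ?_, hx, hxy⟩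
  have hD := mem_interior_iff_mem_nhds.1 hθ
  -- If `x k = 0`, the nonnegative `k`-th coordinates at `θ'` and at its reflection sum to zero. A
  -- whole neighbourhood then needs only `B.erase k`, which genericity forces to span although it
  -- has `n - 1` columns.
  have hrefl : Tendsto (fun θ' : Fin d → ℝ => θ + θ - θ') (𝓝 θ) (𝓝 θ) := by
    have hc : Continuous fun θ' : Fin d → ℝ => θ + θ - θ' := by fun_prop
    simpa using hc.tendsto θ
  have htop : colSpan M (B.erase k) = ⊤ := by
    refine hgen _ (mem_of_eventually_add_mulVec_mem (Q := Q) (θ := θ) ?_)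
    filter_upwards [hD, hrefl hD] with θ' h1 h2
    obtain ⟨a, ha0, ha, hay⟩ := mem_complementaryCone_iff.1 h1
    obtain ⟨b, hb0, hb, hby⟩ := mem_complementaryCone_iff.1 h2
    have hsum : a + b = x + x := by
      refine hB.eq_of_mulVec_eq (fun k hk => by simp [ha k hk, hb k hk])
        (fun k hk => by simp [hx k hk]) ?_
      rw [Matrix.mulVec_add, Matrix.mulVec_add, hay, hby, hxy, Matrix.mulVec_sub,
        Matrix.mulVec_add]
      abel
    have hak : a k = 0 := by
      have := congrFun hsum k
      simp only [Pi.add_apply, hxk] at this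
      linarith [ha0 k, hb0 k]
    rw [← hay]
    refine mulVec_mem_colSpan fun j hj => ?_
    by_cases hjk : j = k
    · rw [hjk, hak]
    · exact ha j fun hjB => hj (Finset.mem_erase.2 ⟨hjk, hjB⟩)
  have h1 := le_card_of_colSpan_eq_top htop
  have h2 := Finset.card_erase_lt_of_mem hk
  rw [hB.1] at h2
  omega

/-- Critical domains that stay full-dimensional after a generic perturbation `p` of `q` do not
overlap. -/
lemma eq_of_mem_interior_of_mem_interior (hM : IsColumnSufficient M) {p : Fin n → ℝ}
    (hgen : ∀ J, q + p ∈ colSpan M J → colSpan M J = ⊤) {B' : Finset (Fin n ⊕ Fin n)}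
    (hB : IsComplementaryBasis M B) (hB' : IsComplementaryBasis M B')
    (hBp : (interior (paramSet (q + p) Q (complementaryCone M B))).Nonempty)
    (hBp' : (interior (paramSet (q + p) Q (complementaryCone M B'))).Nonempty)
    {θ : Fin d → ℝ} (hθ : θ ∈ interior (paramSet q Q (complementaryCone M B)))
    (hθ' : θ ∈ interior (paramSet q Q (complementaryCone M B'))) : B = B' := by
  obtain ⟨η, hη⟩ := hBp
  obtain ⟨η', hη'⟩ := hBp'
  obtain ⟨x, hx, hx0, hxy⟩ := exists_pos_of_mem_interior hgen hB hη
  obtain ⟨x', hx', hx0', hxy'⟩ := exists_pos_of_mem_interior hgen hB' hη'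
  have h1 := (tendsto_add_smul_nhds θ (θ - η)).eventually (mem_interior_iff_mem_nhds.1 hθ)
  have h2 := (tendsto_add_smul_nhds θ (θ - η')).eventually (mem_interior_iff_mem_nhds.1 hθ')
  obtain ⟨s, ⟨hs1, hs2⟩, hs⟩ := ((h1.and h2).and self_mem_nhdsWithin).exists
  have hs : 0 < s := hs
  obtain ⟨u, hu, hu0, huy⟩ := mem_complementaryCone_iff.1 hs1
  obtain ⟨u', hu', hu0', huy'⟩ := mem_complementaryCone_iff.1 hs2
  -- Having moved away from `η` and `η'`, these cancel: both right-hand sides equal `(1 + s) • (q +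
  -- Q *ᵥ θ) + s • p`.
  refine eq_of_pos_of_mulVec_eq hM hB.2.2 hB'.2.2 (a := s • x + u) (b := s • x' + u')
    (fun k hk => ?_) (fun k hk => by simp [hx0 k hk, hu0 k hk])
    (fun k hk => ?_) (fun k hk => by simp [hx0' k hk, hu0' k hk]) ?_
  · exact add_pos_of_pos_of_nonneg (mul_pos hs (hx k hk)) (hu k)
  · exact add_pos_of_pos_of_nonneg (mul_pos hs (hx' k hk)) (hu' k)
  · simp only [Matrix.mulVec_add, Matrix.mulVec_smul, hxy, hxy', huy, huy', Matrix.mulVec_sub]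
    module

/-- These `q` form the cone generated by the columns of `A_B`, `-Q` and `Q`, the free parameter
being split into positive and negative parts. -/
lemma isClosed_setOf_paramSet_nonempty (Q : Matrix (Fin n) (Fin d) ℝ) :
    IsClosed {q : Fin n → ℝ | (paramSet q Q (complementaryCone M B)).Nonempty} := by
  convert isClosed_cone (Matrix.fromCols (colSubmatrix M B) (Matrix.fromCols (-Q) Q)) using 1
  ext q
  constructor
  · rintro ⟨θ, u, hu, huy⟩
    refine ⟨Sum.elim u (Sum.elim θ⁺ θ⁻), ?_, ?_⟩
    · rintro (k | k | k)
      exacts [hu k, posPart_nonneg θ k, negPart_nonneg θ k]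
    · have h := posPart_sub_negPart θ
      rw [Matrix.fromCols_mulVec_sumElim, Matrix.fromCols_mulVec_sumElim, huy, Matrix.neg_mulVec]
      nth_rewrite 1 [← h]
      rw [Matrix.mulVec_sub]
      abel
  · rintro ⟨x, hx, rfl⟩
    refine ⟨x ∘ Sum.inr ∘ Sum.inl - x ∘ Sum.inr ∘ Sum.inr, x ∘ Sum.inl, fun k => hx _, ?_⟩
    rw [Matrix.fromCols_mulVec, Matrix.fromCols_mulVec, Matrix.neg_mulVec, Matrix.mulVec_sub]
    simp only [Function.comp_assoc]
    abel

lemma eventually_paramSet_nonempty (M : Matrix (Fin n) (Fin n) ℝ) (q : Fin n → ℝ)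
    (Q : Matrix (Fin n) (Fin d) ℝ) :
    ∀ᶠ ε : ℝ in 𝓝[>] 0, ∀ B,
      (paramSet (q + lexVector n ε) Q (complementaryCone M B)).Nonempty →
        (paramSet q Q (complementaryCone M B)).Nonempty := by
  refine eventually_all.2 fun B => ?_
  by_cases h : (paramSet q Q (complementaryCone M B)).Nonempty
  · exact Eventually.of_forall fun _ _ => h
  · exact ((tendsto_add_lexVector q).eventually
      ((isClosed_setOf_paramSet_nonempty Q).isOpen_compl.mem_nhds h)).mono
        fun ε hε h' => absurd h' hε

end Perturbation

/-! ### Covering by full-dimensional critical domains -/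

section CriticalDomains

variable {n d : ℕ} {M : Matrix (Fin n) (Fin n) ℝ} {q : Fin n → ℝ} {Q : Matrix (Fin n) (Fin d) ℝ}
  {B : Finset (Fin n ⊕ Fin n)}

lemma affDim_criticalDomain_eq_iff (hQ : Q.rank = d) :
    affDim (criticalDomain M q Q B) = (d : WithBot ℕ) ↔
      (interior (paramSet q Q (complementaryCone M B))).Nonempty :=
  affDim_inter_affineSpace_eq_iff hQ convex_complementaryCone

lemma mem_verts_criticalDomainGraph_iff (hQ : Q.rank = d) :
    B ∈ (criticalDomainGraph M q Q).verts ↔ IsComplementaryBasis M B ∧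
      (interior (paramSet q Q (complementaryCone M B))).Nonempty := by
  rw [← affDim_criticalDomain_eq_iff hQ]
  rfl

/-- After a positive generic perturbation, the full-dimensional critical domains cover the
perturbed feasible points. -/
lemma exists_mem_verts_add_mem (hQ : Q.rank = d) (hM : IsColumnSufficient Mᵀ) {p : Fin n → ℝ}
    (hp : ∀ i, 0 < p i) (hgen : ∀ J, q + p ∈ colSpan M J → colSpan M J = ⊤) {y : Fin n → ℝ}
    (hy : y ∈ feasibleSet M q Q) :
    ∃ B ∈ (criticalDomainGraph M (q + p) Q).verts, y + p ∈ complementaryCone M B := by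
  obtain ⟨hyK, θ, rfl⟩ := hy
  -- As `p > 0`, right-hand sides at parameters near `θ` dominate a solvable one, hence are
  -- solvable; this gives an open set covered by complementary cones.
  have hU : IsOpen {η : Fin d → ℝ | ∀ i, (q + Q *ᵥ θ) i < ((q + p) + Q *ᵥ η) i} := by
    simp only [Set.ofPred_forall]
    exact isOpen_iInter_of_finite fun i => isOpen_lt continuous_const (by fun_prop)
  obtain ⟨J, ⟨hcard, hJ⟩, hθJ, hint⟩ := exists_mem_interior_nonempty
    (D := fun J => paramSet (q + p) Q (complementaryCone M J))
    (p := fun J => J.card = n ∧ ∀ i, Xor (Sum.inl i ∈ J) (Sum.inr i ∈ J))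
    (fun J => isClosed_paramSet _ _ isClosed_complementaryCone) hU (fun η hη => by
      refine exists_mem_complementaryCone ?_
      have := add_mem_complementaryRange hM hyK (p := (q + p) + Q *ᵥ η - (q + Q *ᵥ θ))
        fun i => sub_nonneg.2 (hη i).le
      rwa [add_sub_cancel] at this) (x := θ) (fun i => by simpa using hp i)
  refine ⟨J, (mem_verts_criticalDomainGraph_iff hQ).2 ⟨⟨hcard, ?_, hJ⟩, hint⟩, ?_⟩
  · exact rank_colSubmatrix_of_colSpan_eq_top (colSpan_eq_top_of_interior_nonempty hgen hint)
  · rw [add_right_comm]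
    exact hθJ

/-- If the feasible set is full-dimensional and covered by critical domains, then it is covered by
the full-dimensional ones among them. -/
lemma exists_mem_criticalDomain_of_cover (hQ : Q.rank = d) (hM : IsColumnSufficient Mᵀ)
    (hdim : affDim (feasibleSet M q Q) = (d : WithBot ℕ)) {W : Set (Finset (Fin n ⊕ Fin n))}
    (hW : ∀ y ∈ feasibleSet M q Q, ∃ B ∈ W, y ∈ complementaryCone M B) {y : Fin n → ℝ}
    (hy : y ∈ feasibleSet M q Q) :
    ∃ B ∈ W, affDim (criticalDomain M q Q B) = (d : WithBot ℕ) ∧ y ∈ criticalDomain M q Q B := by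
  have hK : Convex ℝ (complementaryRange M) := by
    rw [complementaryRange_eq_cone hM]; exact convex_cone _
  have hint := (affDim_inter_affineSpace_eq_iff hQ hK).1 hdim
  set F := paramSet q Q (complementaryRange M)
  set G : Set (Fin d → ℝ) := ⋃ B ∈ {B | B ∈ W ∧
    (interior (paramSet q Q (complementaryCone M B))).Nonempty},
      paramSet q Q (complementaryCone M B)
  have hG : IsClosed G := (Set.toFinite _).isClosed_biUnion fun B _ =>
    isClosed_paramSet _ _ isClosed_complementaryCone
  have hFG : interior F ⊆ G := fun θ hθ => by
    obtain ⟨B, hBW, hB, hBint⟩ := exists_mem_interior_nonempty (p := (· ∈ W))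
      (D := fun B => paramSet q Q (complementaryCone M B))
      (fun B => isClosed_paramSet _ _ isClosed_complementaryCone) isOpen_interior
      (fun η (hη : η ∈ interior F) => hW _ ⟨interior_subset (s := F) hη, η, rfl⟩) hθ
    exact Set.mem_biUnion (x := B) ⟨hBW, hBint⟩ hB
  obtain ⟨hyK, θ, rfl⟩ := hy
  -- A convex set with nonempty interior lies in the closure of that interior, so covering the
  -- interior by a closed set suffices.
  have hθ : θ ∈ closure (interior F) := by
    rw [(convex_paramSet q Q hK).closure_interior_eq_closure_of_nonempty_interior hint]
    exact subset_closure hyK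
  have hθG := closure_minimal hFG hG hθ
  simp only [G, Set.mem_iUnion] at hθG
  obtain ⟨B, ⟨hBW, hBint⟩, hB⟩ := hθG
  exact ⟨B, hBW, (affDim_criticalDomain_eq_iff hQ).2 hBint, hB, θ, rfl⟩

end CriticalDomains

end ParamLCP

/-! ### The main theorem -/

open Filter Topology ParamLCP in
theorem mainTheorem1 {n d : ℕ} (M : Matrix (Fin n) (Fin n) ℝ) (q : Fin n → ℝ)
    (Q : Matrix (Fin n) (Fin d) ℝ) (hQ : Q.rank = d) (hM : ParamLCP.IsSufficient M) :
    ∃ δ : ℝ, 0 < δ ∧ ∀ ε : ℝ, 0 < ε → ε < δ →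
      ∀ Vε V : Set (Finset (Fin n ⊕ Fin n)),
        Vε = (ParamLCP.criticalDomainGraph M (q + ParamLCP.lexVector n ε) Q).verts →
        V = {B ∈ Vε | ParamLCP.affDim (ParamLCP.criticalDomain M q Q B) = (d : WithBot ℕ)} →
        (∀ B ∈ Vε, (ParamLCP.criticalDomain M q Q B).Nonempty) ∧
        (∀ B₁ ∈ V, ∀ B₂ ∈ V, B₁ ≠ B₂ →
          Disjoint (intrinsicInterior ℝ (ParamLCP.criticalDomain M q Q B₁))
            (intrinsicInterior ℝ (ParamLCP.criticalDomain M q Q B₂))) ∧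
        ((ParamLCP.feasibleSet M q Q = ∅ ∨
            ParamLCP.affDim (ParamLCP.feasibleSet M q Q) = (d : WithBot ℕ)) →
          (⋃ B ∈ V, ParamLCP.criticalDomain M q Q B) = ParamLCP.feasibleSet M q Q ∧
          ParamLCP.IsPolyhedralDecomposition d (ParamLCP.criticalDomain M q Q '' V)
            (ParamLCP.feasibleSet M q Q)) := by
  let N : ℝ → Set (Finset (Fin n ⊕ Fin n)) := fun ε =>
    (criticalDomainGraph M (q + lexVector n ε) Q).verts
  have hev := (eventually_colSpan_eq_top M q).and
    ((eventually_paramSet_nonempty M q Q).and (eventually_frequently_eq (𝓝[>] 0) N))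
  obtain ⟨δ, hδ, hsub⟩ := mem_nhdsGT_iff_exists_Ioo_subset.1 hev
  refine ⟨δ, hδ, fun ε hε0 hεδ Vε V hVε hV => ?_⟩
  obtain ⟨hgen, hne, hfreq⟩ := hsub ⟨hε0, hεδ⟩
  have hbasis : ∀ B ∈ Vε, IsComplementaryBasis M B ∧
      (interior (paramSet (q + lexVector n ε) Q (complementaryCone M B))).Nonempty :=
    fun B hB => (mem_verts_criticalDomainGraph_iff hQ).1 (hVε ▸ hB)
  have hVmem : ∀ B, B ∈ V ↔ B ∈ Vε ∧ affDim (criticalDomain M q Q B) = (d : WithBot ℕ) :=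
    fun B => by rw [hV]; rfl
  have hoverlap : ∀ B₁ ∈ V, ∀ B₂ ∈ V, ∀ θ,
      θ ∈ interior (paramSet q Q (complementaryCone M B₁)) →
      θ ∈ interior (paramSet q Q (complementaryCone M B₂)) → B₁ = B₂ :=
    fun B₁ h₁ B₂ h₂ θ hθ₁ hθ₂ => by
      obtain ⟨hb₁, hi₁⟩ := hbasis B₁ ((hVmem B₁).1 h₁).1
      obtain ⟨hb₂, hi₂⟩ := hbasis B₂ ((hVmem B₂).1 h₂).1
      exact eq_of_mem_interior_of_mem_interior hM.1 hgen hb₁ hb₂ hi₁ hi₂ hθ₁ hθ₂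
  refine ⟨fun B hB => ?_, fun B₁ h₁ B₂ h₂ h₁₂ => ?_, fun hdim => ?_⟩
  · obtain ⟨θ, hθ⟩ := hne B ((hbasis B hB).2.mono interior_subset)
    exact ⟨_, hθ, θ, rfl⟩
  · refine Set.disjoint_left.2 fun y hy₁ hy₂ => h₁₂ ?_
    obtain ⟨θ, hθ, hθy⟩ := exists_mem_interior_of_mem_intrinsicInterior hQ
      convex_complementaryCone ((hVmem B₁).1 h₁).2 hy₁
    obtain ⟨θ', hθ', hθy'⟩ := exists_mem_interior_of_mem_intrinsicInterior hQ
      convex_complementaryCone ((hVmem B₂).1 h₂).2 hy₂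
    have hinj := mulVec_injective_of_rank_eq (T := Q) (by simpa using hQ)
    have : θ = θ' := hinj (add_left_cancel (hθy.trans hθy'.symm))
    exact hoverlap B₁ h₁ B₂ h₂ θ hθ (this ▸ hθ')
  · have hcover : (⋃ B ∈ V, criticalDomain M q Q B) = feasibleSet M q Q := by
      refine Set.Subset.antisymm (Set.iUnion₂_subset fun B hB => ?_) fun y hy => ?_
      · exact Set.inter_subset_inter_left _ (complementaryCone_subset_complementaryRange
          (hbasis B ((hVmem B).1 hB).1).1.2.2)
      · rcases hdim with hempty | hdim
        · rw [hempty] at hy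
          exact hy.elim
        have hW : ∀ y ∈ feasibleSet M q Q, ∃ B ∈ Vε, y ∈ complementaryCone M B := fun y hy => by
          have hclosed : IsClosed (⋃ B ∈ Vε, complementaryCone M B) :=
            (Set.toFinite _).isClosed_biUnion fun B _ => isClosed_complementaryCone
          -- Only those `ε'` whose node set equals that of the fixed `ε` are used; they accumulate
          -- at `0`.
          have hmem := hclosed.mem_of_frequently_of_tendsto (f := fun ε' => y + lexVector n ε')
            (b := 𝓝[>] 0) ?_ (tendsto_add_lexVector y)
          · simpa using hmem
          refine (hfreq.and_eventually ((eventually_colSpan_eq_top M q).and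
            self_mem_nhdsWithin)).mono fun ε' ⟨hN, hgen', hε'⟩ => ?_
          obtain ⟨B, hB, hyB⟩ := exists_mem_verts_add_mem hQ hM.2 (lexVector_pos hε') hgen' hy
          exact Set.mem_biUnion (x := B) (by rw [hVε]; exact hN.subset hB) hyB
        obtain ⟨B, hBW, hBdim, hyB⟩ := exists_mem_criticalDomain_of_cover hQ hM.2 hdim hW hy
        exact Set.mem_biUnion (x := B) ((hVmem B).2 ⟨hBW, hBdim⟩) hyB
    refine ⟨hcover, ?_, ?_, ?_, ?_⟩
    · rintro _ ⟨B, hB, rfl⟩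
      exact (hbasis B ((hVmem B).1 hB).1).1.isPolyhedron_complementaryCone.inter
        (isPolyhedron_affineSpace q hQ)
    · rw [Set.biUnion_image]
      exact hcover
    · rintro _ ⟨B, hB, rfl⟩
      exact ((hVmem B).1 hB).2
    · rintro _ ⟨B, hB, rfl⟩ _ ⟨B', hB', rfl⟩ hBB'
      have hinter : criticalDomain M q Q B ∩ criticalDomain M q Q B' =
          (complementaryCone M B ∩ complementaryCone M B') ∩ affineSpace q Q :=
        (Set.inter_inter_distrib_right _ _ _).symm
      rw [hinter]
      refine lt_of_le_of_ne ?_ fun heq => hBB' ?_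
      · rw [affDim_inter_affineSpace q hQ]
        exact affDim_le _
      -- A `d`-dimensional intersection would supply a common interior parameter, making the two
      -- bases equal.
      · obtain ⟨θ, hθ⟩ := (affDim_inter_affineSpace_eq_iff hQ
          (convex_complementaryCone.inter convex_complementaryCone)).1 heq
        rw [hoverlap B hB B' hB' θ (interior_mono (fun _ h => h.1) hθ)
          (interior_mono (fun _ h => h.2) hθ)]
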